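/- Let $(R,\mathfrak m,k)$ be a complete Noetherian local ring and let $E=E_R(k)$ be the injective hull of $k$; write $M^\vee=\operatorname{Hom}_R(M,E)$. Let $\alpha$ be a preradical on the class $\mathcal A$ of Artinian $R$-modules, i.e. an assignment of a submodule $\alpha(M)\subseteq M$ to each $M\in\mathcal A$ such that $g(\alpha(M))\subseteq\alpha(N)$ for every $R$-linear map $g\colon M\to N$ in $\mathcal A$. Its finitistic version is the preradical $\alpha_f(N)=\bigcup\{\alpha(M): M\subseteq N \text{ finitely generated}\}$. For a submodule $L\subseteq M$ with $M/L$ Artinian let $L\subseteq L^{\mathrm{cl}}_M\subseteq M$ and $L\subseteq L^{\mathrm{cl}_f}_M\subseteq M$ be the submodules with $L^{\mathrm{cl}}_M/L=\alpha(M/L)$ and $L^{\mathrm{cl}_f}_M/L=\alpha_f(M/L)$. Assume that $\mathrm{cl}$ and $\mathrm{cl}_f$ are closure operations, i.e. they are extensive, idempotent and order-preserving in $L$ for fixed $M$. For an ideal $I$ of $R$, the module $I^\vee$ is Artinian, and $\alpha^\smallsmile(I):=(I^\vee/\alpha(I^\vee))^\vee$, regarded as a submodule of $I^{\vee\vee}\cong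 I$; similarly for $(\alpha_f)^\smallsmile(I)$. Write $\operatorname{ann}_M(I)=\{x\in M: Ix=0\}$, $(J:K)=\{r\in R: rK\subseteq J\}$, and $\lambda$ for length. Then $E$ is Artinian and, for every ideal $I$ of $R$, $$\alpha^\smallsmile(I)=\operatorname{ann}_R\big((\operatorname{ann}_E(I))^{\mathrm{cl}}_E\big)=\bigcap_{M\in\mathcal A}\operatorname{ann}_R\big((\operatorname{ann}_M(I))^{\mathrm{cl}}_M\big)\subseteq(\alpha_f)^\smallsmile(I),$$ $$(\alpha_f)^\smallsmile(I)=\operatorname{ann}_R\big((\operatorname{ann}_E(I))^{\mathrm{cl}_f}_E\big)=\bigcap_{M\subseteq E\text{ f.g.}}\operatorname{ann}_R\big((\operatorname{ann}_M(I))^{\mathrm{cl}}_M\big)=\bigcap_{\lambda(M)<\infty}\operatorname{ann}_R\big((\operatorname{ann}_M(I))^{\mathrm{cl}}_M\big),$$ $$(\alpha_f)^\smallsmile(I)\subseteq\bigcap_{\lambda(R/J)<\infty}\operatorname{ann}_R\big((\operatorname{ann}_{R/J}(I))^{\mathrm{cl}}_{R/J}\big)=\bigcap_{\lambda(R/J)<\infty}\big(J:(J:I)^{\mathrm{cl}}_R\big).$$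 Moreover, suppose that $R$ is approximately Gorenstein, i.e. there is a decreasing sequence of $\mathfrak m$-primary ideals, cofinal with the powers of $\mathfrak m$, whose quotient rings are Gorenstein (have one-dimensional socle). Then the last containment is an equality, and for every decreasing sequence $\{J_t\}_{t\ge 0}$ of irreducible ideals that is cofinal with the powers of $\mathfrak m$ (every $\mathfrak m^n$ contains some $J_t$ and every $J_t$ contains some $\mathfrak m^n$), $$(\alpha_f)^\smallsmile(I)=\bigcap_{t\ge 0}\big(J_t:(J_t:I)^{\mathrm{cl}}_R\big).$$ -/

import Mathlib

universe u

/-- A submodule selector on the class of Artinian `R`-modules: it assigns to every Artinian module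
`M` a submodule of `M`, compatibly with isomorphisms. -/
structure ArtinianSelector (R : Type u) [CommRing R] where
  sel : ∀ (M : Type u) [AddCommGroup M] [Module R M] [IsArtinian R M], Submodule R M
  map_equiv : ∀ (M N : Type u) [AddCommGroup M] [Module R M] [IsArtinian R M]
    [AddCommGroup N] [Module R N] [IsArtinian R N] (e : M ≃ₗ[R] N),
    (sel M).map (e : M →ₗ[R] N) = sel N

/-- A functorial submodule selector (a preradical) on the class of Artinian `R`-modules. -/
structure ArtinianPreradical (R : Type u) [CommRing R] extends ArtinianSelector R where
  functorial : ∀ (M N : Type u) [AddCommGroup M] [Module R M] [IsArtinian R M]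
    [AddCommGroup N] [Module R N] [IsArtinian R N] (g : M →ₗ[R] N),
    (sel M).map g ≤ sel N

/-- For submodules `U ≤ V` of an Artinian module, a functorial selector maps the selected
submodule of `U` into the selected submodule of `V`. -/
theorem ArtinianPreradical.sel_le {R : Type u} [CommRing R] (α : ArtinianPreradical R)
    {M : Type u} [AddCommGroup M] [Module R M] [IsArtinian R M] {U V : Submodule R M}
    (h : U ≤ V) : (α.sel U).map U.subtype ≤ (α.sel V).map V.subtype := by
  rintro _ ⟨y, hy, rfl⟩
  exact ⟨Submodule.inclusion h y, α.functorial U V (Submodule.inclusion h) ⟨y, hy, rfl⟩, rfl⟩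

/-- The value at `N` of the finitistic version of `α`: the union of the submodules `α(M)`, where
`M` runs over the finitely generated submodules of `N`. -/
def ArtinianPreradical.finitisticSel {R : Type u} [CommRing R] (α : ArtinianPreradical R)
    (N : Type u) [AddCommGroup N] [Module R N] [IsArtinian R N] : Submodule R N where
  carrier := ⋃ (M : Submodule R N) (_ : M.FG), ((α.sel M).map M.subtype : Set N)
  zero_mem' := by
    simp only [Set.mem_iUnion]
    exact ⟨⊥, Submodule.fg_bot, Submodule.zero_mem _⟩
  add_mem' := by
    intro a b ha hb
    simp only [Set.mem_iUnion] at ha hb ⊢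
    obtain ⟨U, hU, ha⟩ := ha
    obtain ⟨V, hV, hb⟩ := hb
    exact ⟨U ⊔ V, hU.sup hV,
      Submodule.add_mem _ (α.sel_le le_sup_left ha) (α.sel_le le_sup_right hb)⟩
  smul_mem' := by
    intro r a ha
    simp only [Set.mem_iUnion] at ha ⊢
    obtain ⟨U, hU, ha⟩ := ha
    exact ⟨U, hU, Submodule.smul_mem _ r ha⟩

theorem ArtinianPreradical.finitisticSel_map_le {R : Type u} [CommRing R]
    (α : ArtinianPreradical R) (M N : Type u) [AddCommGroup M] [Module R M] [IsArtinian R M]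
    [AddCommGroup N] [Module R N] [IsArtinian R N] (g : M →ₗ[R] N) :
    (α.finitisticSel M).map g ≤ α.finitisticSel N := by
  rintro _ ⟨x, hx, rfl⟩
  change x ∈ ⋃ (U : Submodule R M) (_ : U.FG), ((α.sel U).map U.subtype : Set M) at hx
  change g x ∈ ⋃ (U : Submodule R N) (_ : U.FG), ((α.sel U).map U.subtype : Set N)
  simp only [Set.mem_iUnion] at hx ⊢
  obtain ⟨U, hU, y, hy, rfl⟩ := hx
  let g' : U →ₗ[R] U.map g := g.restrict fun z hz => Submodule.mem_map_of_mem hz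
  exact ⟨U.map g, hU.map g, g' y, α.functorial U (U.map g) g' ⟨y, hy, rfl⟩, rfl⟩

/-- The finitistic version `α_f` of a preradical `α`, again a preradical. -/
def ArtinianPreradical.finitistic {R : Type u} [CommRing R] (α : ArtinianPreradical R) :
    ArtinianPreradical R where
  sel := fun N _ _ _ => α.finitisticSel N
  map_equiv := by
    intro M N _ _ _ _ _ _ e
    refine le_antisymm (α.finitisticSel_map_le M N e) fun x hx => ?_
    exact ⟨e.symm x, α.finitisticSel_map_le N M e.symm ⟨x, hx, rfl⟩, by simp⟩
  functorial := fun M N _ _ _ _ _ _ g => α.finitisticSel_map_le M N g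

/-- The operation `cl` associated with a selector `α`: for a submodule `L` of `M` such that `M / L`
is Artinian, `L^cl_M` is the submodule of `M` containing `L` with `L^cl_M / L = α(M / L)`. -/
def ArtinianSelector.cl {R : Type u} [CommRing R] (α : ArtinianSelector R)
    {M : Type u} [AddCommGroup M] [Module R M] (L : Submodule R M) (h : IsArtinian R (M ⧸ L)) :
    Submodule R M :=
  (α.sel (M ⧸ L)).comap L.mkQ

/-- A closure operation, defined on the pairs `L ⊆ M` of `R`-modules with `M / L` Artinian:
extensive, idempotent, and order-preserving on submodules. -/
structure IsClosureOperation {R : Type u} [CommRing R]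
    (c : ∀ (M : Type u) [AddCommGroup M] [Module R M] (L : Submodule R M),
      IsArtinian R (M ⧸ L) → Submodule R M) : Prop where
  le_closure : ∀ (M : Type u) [AddCommGroup M] [Module R M] (L : Submodule R M)
    (h : IsArtinian R (M ⧸ L)), L ≤ c M L h
  idempotent : ∀ (M : Type u) [AddCommGroup M] [Module R M] (L : Submodule R M)
    (h : IsArtinian R (M ⧸ L)) (h' : IsArtinian R (M ⧸ c M L h)), c M (c M L h) h' = c M L h
  mono : ∀ (M : Type u) [AddCommGroup M] [Module R M] (L N : Submodule R M)
    (hL : IsArtinian R (M ⧸ L)) (hN : IsArtinian R (M ⧸ N)), L ≤ N → c M L hL ≤ c M N hN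

/-- The dual `α^⌣` of a selector `α` with respect to the Matlis duality `M^∨ = Hom_R(M, E)`:
`α^⌣(M) = (M^∨ / α(M^∨))^∨`, embedded in `M^∨^∨` by composition with `M^∨ → M^∨ / α(M^∨)`, and
regarded as a submodule of `M` through the evaluation map `M → M^∨^∨`. -/
def ArtinianSelector.smile {R : Type u} [CommRing R] (α : ArtinianSelector R)
    (E : Type u) [AddCommGroup E] [Module R E]
    (M : Type u) [AddCommGroup M] [Module R M] (h : IsArtinian R (M →ₗ[R] E)) :
    Submodule R M :=
  (LinearMap.range (LinearMap.lcomp R E (α.sel (M →ₗ[R] E)).mkQ)).comap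
    (LinearMap.applyₗ : M →ₗ[R] (M →ₗ[R] E) →ₗ[R] E)

/-- `α^⌣(I)` for an ideal `I`, as an ideal of `R` contained in `I`. -/
def ArtinianSelector.smileIdeal {R : Type u} [CommRing R] (α : ArtinianSelector R)
    (E : Type u) [AddCommGroup E] [Module R E] (I : Ideal R) (h : IsArtinian R (I →ₗ[R] E)) :
    Ideal R :=
  (α.smile E I h).map (Submodule.subtype I)

/-- `E` is an injective hull of `k`: an injective module that is an essential extension of (a copy
of) `k`. -/
def IsInjectiveHull (R : Type u) [CommRing R] (k : Type u) [AddCommGroup k] [Module R k]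
    (E : Type u) [AddCommGroup E] [Module R E] : Prop :=
  Module.Injective R E ∧ ∃ i : k →ₗ[R] E, Function.Injective i ∧
    ∀ N : Submodule R E, N ≠ ⊥ → LinearMap.range i ⊓ N ≠ ⊥

/-- The submodule `ann_M(I)` of the elements of `M` killed by the ideal `I`. -/
def annIn {R : Type u} [CommRing R] (M : Type u) [AddCommGroup M] [Module R M] (I : Ideal R) :
    Submodule R M :=
  Submodule.torsionBySet R M (I : Set R)

/-- The colon ideal `(J : K) = {r ∈ R | r K ⊆ J}`. -/
def idealColon {R : Type u} [CommRing R] (J K : Ideal R) : Ideal R :=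
  Submodule.colon J (K : Set R)

/-- The sequence of ideals `J` is cofinal with the powers of the maximal ideal. -/
def CofinalWithPowers {R : Type u} [CommRing R] [IsLocalRing R] (J : ℕ → Ideal R) : Prop :=
  (∀ n : ℕ, ∃ t, J t ≤ IsLocalRing.maximalIdeal R ^ n) ∧
    ∀ t, ∃ n : ℕ, IsLocalRing.maximalIdeal R ^ n ≤ J t

/-- `R` is approximately Gorenstein: there is a decreasing sequence of ideals `J t`, cofinal with
the powers of the maximal ideal, such that each (Artinian local) ring `R / J t` is Gorenstein, that
is, has a socle which is one-dimensional over (equivalently, isomorphic to) the residue field. -/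
def IsApproximatelyGorenstein (R : Type u) [CommRing R] [IsLocalRing R] : Prop :=
  ∃ J : ℕ → Ideal R, Antitone J ∧ CofinalWithPowers J ∧
    ∀ t, IsSimpleModule R (annIn (R ⧸ J t) (IsLocalRing.maximalIdeal R))

theorem isArtinian_quotient_mono {R : Type u} [CommRing R] {J K : Ideal R} (h : J ≤ K)
    (hJ : IsArtinian R (R ⧸ J)) : IsArtinian R (R ⧸ K) :=
  isArtinian_of_surjective (R ⧸ J) (Submodule.factor h) (Submodule.factor_surjective h)

theorem isArtinian_quotient_idealColon {R : Type u} [CommRing R] {J : Ideal R}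
    (hJ : IsArtinian R (R ⧸ J)) (I : Ideal R) : IsArtinian R (R ⧸ idealColon J I) :=
  isArtinian_quotient_mono Ideal.le_colon hJ

theorem isArtinian_of_isFiniteLength {R : Type u} [CommRing R] {M : Type u} [AddCommGroup M]
    [Module R M] (h : IsFiniteLength R M) : IsArtinian R M :=
  (isFiniteLength_iff_isNoetherian_isArtinian.mp h).2

theorem isArtinian_quotient_of_pow_le {R : Type u} [CommRing R] [IsLocalRing R]
    [IsNoetherianRing R] {J : Ideal R} {n : ℕ} (h : IsLocalRing.maximalIdeal R ^ n ≤ J) :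
    IsArtinian R (R ⧸ J) := by
  refine isArtinian_quotient_mono h ?_
  rcases Nat.eq_zero_or_pos n with rfl | hn
  · have : Subsingleton (R ⧸ IsLocalRing.maximalIdeal R ^ 0) :=
      Ideal.Quotient.subsingleton_iff.mpr (by simp)
    infer_instance
  · have hm : IsLocalRing.maximalIdeal R ∈ (IsLocalRing.maximalIdeal R ^ n).minimalPrimes :=
      ⟨⟨inferInstance, Ideal.pow_le_self hn.ne'⟩, fun q hq _ => hq.1.le_of_pow_le hq.2⟩
    have := IsLocalRing.quotient_artinian_of_mem_minimalPrimes_of_isLocalRing _ hm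
    exact isArtinian_of_surjective_algebraMap (M := R ⧸ IsLocalRing.maximalIdeal R ^ n)
      (S := R) (R := R ⧸ IsLocalRing.maximalIdeal R ^ n) Ideal.Quotient.mk_surjective

theorem CofinalWithPowers.isArtinian_quotient {R : Type u} [CommRing R] [IsLocalRing R]
    [IsNoetherianRing R] {J : ℕ → Ideal R} (hJ : CofinalWithPowers J) (t : ℕ) :
    IsArtinian R (R ⧸ J t) :=
  (hJ.2 t).elim fun _ h => isArtinian_quotient_of_pow_le h

/-- The ideal `(J : (J : I)^cl_R)`, for an ideal `J` of finite colength. -/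
def ArtinianSelector.colonClColon {R : Type u} [CommRing R] (α : ArtinianSelector R)
    (J I : Ideal R) (hJ : IsArtinian R (R ⧸ J)) : Ideal R :=
  idealColon J (α.cl (idealColon J I) (isArtinian_quotient_idealColon hJ I))

/-!
Since `E` is injective, restriction along `I ⊆ R` identifies `E / ann_E(I)` with `I^∨`, and this
turns `α^⌣(I)` into `ann_R((ann_E(I))^cl)`. Linear maps `M → E` carry closures into closures and
separate the points of `M`, so `E` has the smallest annihilator among all Artinian modules.
A finitistic closure is the union of the closures taken in finitely generated submodules of `E`.
Such a submodule is killed by some `𝔪ⁿ`, hence lies in `ann_E(J)` for any `J ⊆ 𝔪ⁿ`; and if `R / J`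
has a simple socle, then `R / J ≅ ann_E(J)`, so the cyclic modules `R / J` suffice.

For `E` Artinian: an endomorphism of `E` acts on `ann_E(𝔪ⁿ)` as multiplication by an element of
`R`, so a submodule of `E` is determined, inside every submodule containing it, by which elements
of `𝔪ⁿ` kill its part in `ann_E(𝔪ⁿ⁺¹)`. These elements, for all `n`, form an ideal of the Rees
algebra of `𝔪`, which is Noetherian.
-/

open IsLocalRing Polynomial

section Annihilators

variable {R : Type u} [CommRing R] {M N : Type u} [AddCommGroup M] [Module R M]
  [AddCommGroup N] [Module R N]

theorem mem_annIn {I : Ideal R} {x : M} : x ∈ annIn M I ↔ ∀ r ∈ I, r • x = 0 := by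
  simp [annIn, Submodule.mem_torsionBySet_iff]

theorem mem_annIn_span {s : Set R} {x : M} :
    x ∈ annIn M (Ideal.span s) ↔ ∀ r ∈ s, r • x = 0 := by
  rw [annIn, ← Submodule.torsionBySet_eq_torsionBySet_span, Submodule.mem_torsionBySet_iff,
    Subtype.forall]

theorem annIn_antitone : Antitone (annIn M : Ideal R → Submodule R M) := fun _ _ h =>
  Submodule.torsionBySet_le_torsionBySet_of_subset h

theorem annIn_top : annIn M (⊤ : Ideal R) = ⊥ :=
  eq_bot_iff.mpr fun x hx => by simpa using mem_annIn.mp hx 1 trivial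

theorem annIn_le_comap (f : M →ₗ[R] N) (I : Ideal R) : annIn M I ≤ (annIn N I).comap f :=
  fun x hx => mem_annIn.mpr fun r hr => by rw [← map_smul, mem_annIn.mp hx r hr, map_zero]

theorem comap_annIn_of_injective {f : M →ₗ[R] N} (hf : Function.Injective f) (I : Ideal R) :
    (annIn N I).comap f = annIn M I :=
  le_antisymm (fun x hx => mem_annIn.mpr fun r hr => hf <| by
    rw [map_smul, map_zero, mem_annIn.mp hx r hr]) (annIn_le_comap f I)

theorem smul_mem_annIn {I J : Ideal R} {a : R} (ha : a ∈ J) {x : M} (hx : x ∈ annIn M (I * J)) :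
    a • x ∈ annIn M I :=
  mem_annIn.mpr fun r hr => by rw [smul_smul, mem_annIn.mp hx _ (Ideal.mul_mem_mul hr ha)]

theorem exists_smul_ne_zero_mem_annIn {I : Ideal R} {n : ℕ} {x : M} (hx : x ∈ annIn M (I ^ n))
    (hx0 : x ≠ 0) : ∃ s : R, s • x ≠ 0 ∧ s • x ∈ annIn M I := by
  induction n generalizing x with
  | zero => exact absurd (by simpa [Ideal.one_eq_top, annIn_top] using hx) hx0
  | succ n ih =>
    by_cases h : ∃ t ∈ I, t • x ≠ 0
    · obtain ⟨t, ht, htx⟩ := h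
      obtain ⟨s, hs⟩ := ih (smul_mem_annIn ht (pow_succ I n ▸ hx)) htx
      exact ⟨s * t, by simpa only [mul_smul] using hs⟩
    · push Not at h
      exact ⟨1, by rwa [one_smul], by rwa [one_smul, mem_annIn]⟩

theorem annIn_quotient_self {J : Ideal R} : annIn (R ⧸ J) J = ⊤ :=
  eq_top_iff.mpr fun x _ => mem_annIn.mpr fun r hr => by
    rw [Algebra.smul_def, Ideal.Quotient.algebraMap_eq, Ideal.Quotient.eq_zero_iff_mem.mpr hr,
      zero_mul]

theorem comap_mkQ_annIn (J I : Ideal R) : (annIn (R ⧸ J) I).comap J.mkQ = idealColon J I := by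
  ext x
  rw [Submodule.mem_comap, mem_annIn]
  refine Iff.trans (forall₂_congr fun r _ => ?_) Submodule.mem_colon.symm
  rw [← map_smul, Submodule.mkQ_apply, Submodule.Quotient.mk_eq_zero, smul_eq_mul, smul_eq_mul,
    mul_comm]

theorem idealColon_comap_mkQ (J : Ideal R) (K : Submodule R (R ⧸ J)) :
    idealColon J (K.comap J.mkQ) = K.annihilator := by
  rw [idealColon, ← Submodule.annihilator_map_mkQ_eq_colon,
    Submodule.map_comap_eq_of_surjective J.mkQ_surjective]

/-- The `I`-power torsion modules: every element is killed by some power of `I`. -/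
def IsPowerTorsion (I : Ideal R) (M : Type u) [AddCommGroup M] [Module R M] : Prop :=
  ∀ x : M, ∃ n : ℕ, x ∈ annIn M (I ^ n)

theorem isPowerTorsion_quotient_of_pow_le {I J : Ideal R} {n : ℕ} (h : I ^ n ≤ J) :
    IsPowerTorsion I (R ⧸ J) :=
  fun _ => ⟨n, annIn_antitone h (annIn_quotient_self.ge trivial)⟩

theorem IsPowerTorsion.exists_le_annIn_pow {I : Ideal R} (hM : IsPowerTorsion I M)
    {V : Submodule R M} (hV : V.FG) : ∃ n : ℕ, V ≤ annIn M (I ^ n) := by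
  induction V, hV using Submodule.fg_induction with
  | singleton x => exact (hM x).imp fun n hn => (Submodule.span_singleton_le_iff_mem x _).mpr hn
  | sup V W _ _ hV hW =>
    obtain ⟨m, hm⟩ := hV
    obtain ⟨n, hn⟩ := hW
    exact ⟨max m n, sup_le
      (hm.trans (annIn_antitone (Ideal.pow_le_pow_right (le_max_left m n))))
      (hn.trans (annIn_antitone (Ideal.pow_le_pow_right (le_max_right m n))))⟩

/-- The homogeneous ideal of the Rees algebra `⨁ Iⁿ tⁿ` attached to `V ⊆ M`: its degree `n` part
consists of the `a ∈ Iⁿ` that kill the elements of `V` killed by `Iⁿ⁺¹`. It contains `Iⁿ⁺¹ tⁿ`, so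
it is the preimage of an ideal of the associated graded ring of `I`. -/
def reesAnnihilator (I : Ideal R) (V : Submodule R M) : Ideal (reesAlgebra I) where
  carrier := {p | ∀ n, ∀ x ∈ V ⊓ annIn M (I ^ (n + 1)), (p : R[X]).coeff n • x = 0}
  add_mem' hp hq n x hx := by
    simp only [Subalgebra.coe_add, coeff_add, add_smul, hp n x hx, hq n x hx, add_zero]
  zero_mem' n x _ := by simp
  smul_mem' q p hp n x hx := by
    simp only [smul_eq_mul, Subalgebra.coe_mul, coeff_mul, Finset.sum_smul]
    refine Finset.sum_eq_zero fun ij hij => ?_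
    have hn : ij.1 + ij.2 = n := by simpa using hij
    rw [← hn, add_assoc, add_comm, pow_add] at hx
    rw [mul_comm, mul_smul]
    exact hp ij.2 _ ⟨V.smul_mem _ hx.1, smul_mem_annIn (q.2 ij.1) hx.2⟩

theorem reesAnnihilator_antitone (I : Ideal R) :
    Antitone (reesAnnihilator I : Submodule R M → Ideal (reesAlgebra I)) :=
  fun _ _ h _ hp n x hx => hp n x ⟨h hx.1, hx.2⟩

theorem monomial_mem_reesAnnihilator_iff {I : Ideal R} {V : Submodule R M} {n : ℕ} {a : R}
    (ha : a ∈ I ^ n) :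
    ⟨monomial n a, reesAlgebra.monomial_mem.mpr ha⟩ ∈ reesAnnihilator I V ↔
      ∀ x ∈ V ⊓ annIn M (I ^ (n + 1)), a • x = 0 := by
  refine ⟨fun h x hx => by simpa using h n x hx, fun h k x hx => ?_⟩
  obtain rfl | hk := eq_or_ne n k
  · simpa using h x hx
  · simp [coeff_monomial_of_ne a hk.symm]

end Annihilators

section Monolith

variable {R : Type u} [CommRing R] {M N : Type u} [AddCommGroup M] [Module R M]
  [AddCommGroup N] [Module R N] {x : M}

/-- `x` generates the monolith of `M`, the smallest nonzero submodule: `x` is nonzero and lies in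
every nonzero submodule. -/
def IsMonolithGenerator (R : Type u) [CommRing R] {M : Type u} [AddCommGroup M] [Module R M]
    (x : M) : Prop :=
  x ≠ 0 ∧ ∀ V : Submodule R M, V ≠ ⊥ → x ∈ V

theorem IsInjectiveHull.exists_isMonolithGenerator [IsSimpleModule R N]
    (hM : IsInjectiveHull R N M) : ∃ x : M, IsMonolithGenerator R x := by
  obtain ⟨-, i, hi, hess⟩ := hM
  obtain ⟨z, hz⟩ := @exists_ne N (IsSimpleModule.nontrivial R N) 0
  refine ⟨i z, (map_ne_zero_iff i hi).mpr hz, fun V hV => ?_⟩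
  have hcomap : V.comap i ≠ ⊥ := fun h => hess V hV <| by
    rw [← Submodule.map_comap_eq, h, Submodule.map_bot]
  exact ((eq_bot_or_eq_top (V.comap i)).resolve_left hcomap).ge (Submodule.mem_top (x := z))

namespace IsMonolithGenerator

theorem exists_smul_eq (hx : IsMonolithGenerator R x) {y : M} (hy : y ≠ 0) :
    ∃ c : R, c • y = x :=
  Submodule.mem_span_singleton.mp (hx.2 (R ∙ y) (by simpa using hy))

theorem injective (hx : IsMonolithGenerator R x) {f : M →ₗ[R] N} (hf : f x ≠ 0) :
    Function.Injective f :=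
  LinearMap.ker_eq_bot.mp <| by_contra fun h => hf (hx.2 _ h)

variable [IsLocalRing R]

theorem mem_annIn_maximalIdeal (hx : IsMonolithGenerator R x) : x ∈ annIn M (maximalIdeal R) := by
  refine mem_annIn.mpr fun r hr => by_contra fun hrx => hx.1 ?_
  obtain ⟨c, hc⟩ := hx.exists_smul_eq hrx
  have hunit : IsUnit (1 - c * r) := IsLocalRing.isUnit_one_sub_self_of_mem_nonunits _
    ((maximalIdeal R).mul_mem_left c hr)
  exact hunit.smul_eq_zero.mp (by rw [sub_smul, one_smul, mul_smul, hc, sub_self])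

theorem annIn_maximalIdeal_eq_span (hx : IsMonolithGenerator R x) :
    annIn M (maximalIdeal R) = R ∙ x := by
  refine le_antisymm (fun y hy => ?_)
    ((Submodule.span_singleton_le_iff_mem x _).mpr hx.mem_annIn_maximalIdeal)
  obtain rfl | hy0 := eq_or_ne y 0
  · exact zero_mem _
  obtain ⟨c, hc⟩ := hx.exists_smul_eq hy0
  have hunit : IsUnit c := by_contra fun h => hx.1 (hc ▸ mem_annIn.mp hy c h)
  exact (Submodule.smul_mem_iff_of_isUnit _ hunit).mp <| by
    rw [hc]
    exact Submodule.mem_span_singleton_self x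

theorem isPowerTorsion [IsNoetherianRing R] (hx : IsMonolithGenerator R x) :
    IsPowerTorsion (maximalIdeal R) M := by
  by_contra h
  simp only [IsPowerTorsion, mem_annIn] at h
  push Not at h
  obtain ⟨y, hy⟩ := h
  have hy0 : y ≠ 0 := by
    rintro rfl
    obtain ⟨r, -, hr⟩ := hy 0
    exact hr (smul_zero r)
  have hxy : x ∈ R ∙ y := hx.2 _ (by simpa using hy0)
  -- Krull's intersection theorem in `R ∙ y`: otherwise `x` would lie in every `𝔪ⁿ y`.
  have hx0 : (⟨x, hxy⟩ : R ∙ y) = 0 := IsHausdorff.haus' (I := maximalIdeal R) _ fun n => by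
    rw [SModEq.zero]
    obtain ⟨r, hr, hry⟩ := hy n
    obtain ⟨c, hc⟩ := hx.exists_smul_eq hry
    have : (⟨x, hxy⟩ : R ∙ y) = (c * r) • ⟨y, Submodule.mem_span_singleton_self y⟩ :=
      Subtype.ext (hc.symm.trans (mul_smul c r y).symm)
    exact this ▸ Submodule.smul_mem_smul (Ideal.mul_mem_left _ c hr) trivial
  exact hx.1 (congrArg Subtype.val hx0)

theorem of_infIrred_bot (hM : InfIrred (⊥ : Submodule R M)) (hx : x ∈ annIn M (maximalIdeal R))
    (hx0 : x ≠ 0) : IsMonolithGenerator R x := by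
  refine ⟨hx0, fun V hV => ?_⟩
  have hinf : V ⊓ (R ∙ x) ≠ ⊥ := fun h =>
    (hM.2 h).elim hV fun hspan => hx0 (Submodule.span_singleton_eq_bot.mp hspan)
  obtain ⟨_, ⟨hcV, hcx⟩, hc0⟩ := Submodule.exists_mem_ne_zero_of_ne_bot hinf
  obtain ⟨c, rfl⟩ := Submodule.mem_span_singleton.mp hcx
  have hunit : IsUnit c := by_contra fun h => hc0 (mem_annIn.mp hx c h)
  exact (V.smul_mem_iff_of_isUnit hunit).mp hcV

end IsMonolithGenerator

theorem IsPowerTorsion.exists_isMonolithGenerator_of_isSimpleModule_annIn {I : Ideal R}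
    (hM : IsPowerTorsion I M) [IsSimpleModule R (annIn M I)] :
    ∃ x : M, IsMonolithGenerator R x := by
  obtain ⟨z, hz⟩ := @exists_ne _ (IsSimpleModule.nontrivial R (annIn M I)) 0
  refine ⟨z, by simpa using hz, fun V hV => ?_⟩
  obtain ⟨y, hyV, hy0⟩ := Submodule.exists_mem_ne_zero_of_ne_bot hV
  obtain ⟨n, hn⟩ := hM y
  obtain ⟨s, hs0, hs⟩ := exists_smul_ne_zero_mem_annIn hn hy0
  obtain ⟨c, hc⟩ := IsSimpleModule.toSpanSingleton_surjective R
    (m := (⟨s • y, hs⟩ : annIn M I)) (fun h => hs0 (congrArg Subtype.val h)) z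
  exact hc ▸ V.smul_mem c (V.smul_mem s hyV)

theorem IsPowerTorsion.exists_isMonolithGenerator_of_infIrred_bot [IsLocalRing R]
    (hM : IsPowerTorsion (maximalIdeal R) M) (hbot : InfIrred (⊥ : Submodule R M)) :
    ∃ x : M, IsMonolithGenerator R x := by
  obtain ⟨y, -, hy0⟩ := Submodule.exists_mem_ne_zero_of_ne_bot fun h => hbot.ne_top h.symm
  obtain ⟨n, hn⟩ := hM y
  obtain ⟨s, hs0, hs⟩ := exists_smul_ne_zero_mem_annIn hn hy0
  exact ⟨s • y, .of_infIrred_bot hbot hs hs0⟩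

theorem infIrred_bot_quotient {L : Submodule R M} (hL : InfIrred L) :
    InfIrred (⊥ : Submodule R (M ⧸ L)) := by
  have hcomap : (⊥ : Submodule R (M ⧸ L)).comap L.mkQ = L := by
    rw [Submodule.comap_bot, Submodule.ker_mkQ]
  have hinj := Submodule.comap_injective_of_surjective L.mkQ_surjective
  refine ⟨fun h => hL.ne_top ?_, fun V W h => ?_⟩
  · rw [← hcomap, h.eq_top, Submodule.comap_top]
  · have hVW : V.comap L.mkQ ⊓ W.comap L.mkQ = L := by rw [← Submodule.comap_inf, h, hcomap]
    exact (hL.2 hVW).imp (fun h => hinj (h.trans hcomap.symm)) (fun h => hinj (h.trans hcomap.symm))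

end Monolith

section Injective

variable {R : Type u} [CommRing R] {E : Type u} [AddCommGroup E] [Module R E]
  {M N : Type u} [AddCommGroup M] [Module R M] [AddCommGroup N] [Module R N]

theorem exists_comp_eq_of_ker_le [Module.Injective R E] (f : M →ₗ[R] N) (g : M →ₗ[R] E)
    (h : LinearMap.ker f ≤ LinearMap.ker g) : ∃ g' : N →ₗ[R] E, g' ∘ₗ f = g := by
  obtain ⟨g', hg'⟩ := Module.Injective.out ((LinearMap.ker f).liftQ f le_rfl)
    (LinearMap.ker_eq_bot.mp (Submodule.ker_liftQ_eq_bot _ _ _ le_rfl))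
    ((LinearMap.ker f).liftQ g h)
  exact ⟨g', LinearMap.ext fun x => hg' ((LinearMap.ker f).mkQ x)⟩

namespace IsMonolithGenerator

variable [IsLocalRing R] {e : E}

theorem exists_eq_smul_on_annIn_maximalIdeal (he : IsMonolithGenerator R e) (f : E →ₗ[R] E) :
    ∃ c : R, ∀ y ∈ annIn E (maximalIdeal R), f y = c • y := by
  have hfe := annIn_le_comap f _ he.mem_annIn_maximalIdeal
  simp only [he.annIn_maximalIdeal_eq_span, Submodule.mem_comap] at hfe ⊢
  obtain ⟨c, hc⟩ := Submodule.mem_span_singleton.mp hfe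
  refine ⟨c, fun y hy => ?_⟩
  obtain ⟨r, rfl⟩ := Submodule.mem_span_singleton.mp hy
  rw [map_smul, ← hc, smul_comm]

variable [Module.Injective R E]

theorem exists_linearMap_apply_ne_zero (he : IsMonolithGenerator R e) {x : M} (hx : x ≠ 0) :
    ∃ f : M →ₗ[R] E, f x ≠ 0 := by
  obtain ⟨f, hf⟩ := exists_comp_eq_of_ker_le (LinearMap.toSpanSingleton R M x)
    (LinearMap.toSpanSingleton R E e) fun r hr =>
      mem_annIn.mp he.mem_annIn_maximalIdeal r fun hunit => hx (hunit.smul_eq_zero.mp hr)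
  have hfx : f x = e := by simpa using LinearMap.congr_fun hf 1
  exact ⟨f, hfx ▸ he.1⟩

theorem exists_le_ker_apply_ne_zero (he : IsMonolithGenerator R e) {V : Submodule R M} {x : M}
    (hx : x ∉ V) : ∃ f : M →ₗ[R] E, V ≤ LinearMap.ker f ∧ f x ≠ 0 := by
  obtain ⟨f, hf⟩ := he.exists_linearMap_apply_ne_zero
    (mt (Submodule.Quotient.mk_eq_zero V).mp hx)
  exact ⟨f ∘ₗ V.mkQ, (Submodule.ker_mkQ V).ge.trans (LinearMap.ker_le_ker_comp _ _), hf⟩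

theorem annihilator_annIn (he : IsMonolithGenerator R e) (I : Ideal R) :
    (annIn E I).annihilator = I := by
  refine le_antisymm (fun r hr => by_contra fun hrI => ?_) fun r hr =>
    Submodule.mem_annihilator.mpr fun y hy => mem_annIn.mp hy r hr
  obtain ⟨f, hf, hfr⟩ := he.exists_le_ker_apply_ne_zero hrI
  have hf_smul (a : R) : f a = a • f 1 := by rw [← map_smul, smul_eq_mul, mul_one]
  have hf1 : f 1 ∈ annIn E I := mem_annIn.mpr fun a ha => (hf_smul a).symm.trans (hf ha)
  exact hfr ((hf_smul r).trans (Submodule.mem_annihilator.mp hr _ hf1))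

theorem annihilator_le_annihilator (he : IsMonolithGenerator R e) {L : Submodule R E}
    {P : Submodule R M} (h : ∀ f : M →ₗ[R] E, P ≤ L.comap f) :
    L.annihilator ≤ P.annihilator := by
  refine fun r hr => Submodule.mem_annihilator.mpr fun x hx => by_contra fun hne => ?_
  obtain ⟨f, hf⟩ := he.exists_linearMap_apply_ne_zero hne
  exact hf (by rw [map_smul, Submodule.mem_annihilator.mp hr _ (h f hx)])

theorem exists_eq_smul_on_annIn_pow [IsNoetherianRing R] (he : IsMonolithGenerator R e)
    (f : E →ₗ[R] E) (n : ℕ) : ∃ r : R, ∀ y ∈ annIn E (maximalIdeal R ^ n), f y = r • y := by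
  induction n with
  | zero => exact ⟨0, fun y hy => by
      have hy0 : y = 0 := by simpa [Ideal.one_eq_top, annIn_top] using hy
      rw [hy0, map_zero, smul_zero]⟩
  | succ n ih =>
    classical
    obtain ⟨r, hr⟩ := ih
    obtain ⟨t, ht⟩ := IsNoetherian.noetherian (maximalIdeal R ^ n)
    let T := annIn E (maximalIdeal R ^ (n + 1))
    -- `f - r` vanishes on `ann_E(𝔪ⁿ)`, hence factors on `T` through multiplication by the
    -- generators of `𝔪ⁿ`, which maps `T` into copies of the socle.
    let φ : T →ₗ[R] (t → E) := LinearMap.pi fun a => LinearMap.lsmul R E a ∘ₗ T.subtype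
    obtain ⟨h, hh⟩ := exists_comp_eq_of_ker_le φ ((f - r • LinearMap.id) ∘ₗ T.subtype)
      fun y hy => by
        have hyt : (y : E) ∈ annIn E (maximalIdeal R ^ n) := by
          rw [← ht]
          exact mem_annIn_span.mpr fun a ha => congrFun hy ⟨a, ha⟩
        simp [hr y hyt]
    choose c hc using fun a : t =>
      he.exists_eq_smul_on_annIn_maximalIdeal (h ∘ₗ LinearMap.single R (fun _ => E) a)
    refine ⟨r + ∑ a, c a * a, fun y hy => ?_⟩
    have hsum : f y - r • y = ∑ a : t, h (Pi.single a ((a : R) • y)) := by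
      rw [← map_sum, Finset.univ_sum_single (fun a : t => (a : R) • y)]
      exact (LinearMap.congr_fun hh ⟨y, hy⟩).symm
    have hsocle (a : t) : h (Pi.single a ((a : R) • y)) = (c a * a) • y := by
      rw [mul_smul]
      exact hc a _ (smul_mem_annIn (ht ▸ Submodule.subset_span a.2) (by rwa [← pow_succ']))
    rw [add_smul, Finset.sum_smul, ← sub_eq_iff_eq_add', hsum]
    exact Finset.sum_congr rfl fun a _ => hsocle a

theorem exists_mem_annihilator_smul_ne_zero [IsNoetherianRing R] (he : IsMonolithGenerator R e)
    {n : ℕ} {V : Submodule R E} (hV : V ≤ annIn E (maximalIdeal R ^ n)) {x : E}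
    (hx : x ∈ annIn E (maximalIdeal R ^ n)) (hxV : x ∉ V) : ∃ a ∈ V.annihilator, a • x ≠ 0 := by
  obtain ⟨f, hf, hfx⟩ := he.exists_le_ker_apply_ne_zero hxV
  obtain ⟨a, ha⟩ := he.exists_eq_smul_on_annIn_pow f n
  exact ⟨a, Submodule.mem_annihilator.mpr fun y hy => (ha y (hV hy)).symm.trans (hf hy),
    ha x hx ▸ hfx⟩

theorem le_of_reesAnnihilator_le [IsNoetherianRing R] (he : IsMonolithGenerator R e)
    {V W : Submodule R E} (hVW : V ≤ W)
    (h : reesAnnihilator (maximalIdeal R) V ≤ reesAnnihilator (maximalIdeal R) W) : W ≤ V := by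
  suffices hn : ∀ n, W ⊓ annIn E (maximalIdeal R ^ n) ≤ V from fun x hx =>
    (he.isPowerTorsion x).elim fun n hxn => hn n ⟨hx, hxn⟩
  intro n
  induction n with
  | zero => simp [Ideal.one_eq_top, annIn_top]
  | succ n ih =>
    refine fun x hx => by_contra fun hxV => ?_
    have hle : annIn E (maximalIdeal R ^ n) ≤ annIn E (maximalIdeal R ^ (n + 1)) :=
      annIn_antitone (Ideal.pow_le_pow_right n.le_succ)
    let V' := V ⊓ annIn E (maximalIdeal R ^ (n + 1)) ⊔ annIn E (maximalIdeal R ^ n)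
    have hxV' : x ∉ V' := fun hxV' => by
      obtain ⟨y, hy, z, hz, rfl⟩ := Submodule.mem_sup.mp hxV'
      have hzW : z ∈ W := by simpa using W.sub_mem hx.1 (hVW hy.1)
      exact hxV (V.add_mem hy.1 (ih ⟨hzW, hz⟩))
    obtain ⟨a, haV', hax⟩ := he.exists_mem_annihilator_smul_ne_zero
      (sup_le inf_le_right hle) hx.2 hxV'
    have ha : a ∈ maximalIdeal R ^ n := by
      rw [← he.annihilator_annIn (maximalIdeal R ^ n)]
      exact Submodule.annihilator_mono le_sup_right haV'
    have haV := (monomial_mem_reesAnnihilator_iff (V := V) ha).mpr fun y hy =>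
      Submodule.mem_annihilator.mp haV' y (Submodule.mem_sup_left hy)
    exact hax ((monomial_mem_reesAnnihilator_iff ha).mp (h haV) x hx)

theorem isArtinian [IsNoetherianRing R] (he : IsMonolithGenerator R e) : IsArtinian R E :=
  StrictAnti.wellFoundedLT (f := reesAnnihilator (maximalIdeal R)) fun _ _ h =>
    (reesAnnihilator_antitone _ h.le).lt_of_not_ge fun h' =>
      h.not_ge (he.le_of_reesAnnihilator_le h.le h')

theorem nonempty_quotient_equiv_annIn [IsNoetherianRing R] (he : IsMonolithGenerator R e)
    {J : Ideal R} {n : ℕ} (hJ : maximalIdeal R ^ n ≤ J) {x : R ⧸ J}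
    (hx : IsMonolithGenerator R x) : Nonempty ((R ⧸ J) ≃ₗ[R] annIn E J) := by
  obtain ⟨j, hjx⟩ := he.exists_linearMap_apply_ne_zero hx.1
  have hj : Function.Injective j := hx.injective hjx
  have hj_mem (z : R ⧸ J) : j z ∈ annIn E J :=
    annIn_le_comap j J (annIn_quotient_self.ge trivial)
  refine ⟨LinearEquiv.ofBijective (j.codRestrict _ hj_mem)
    ⟨(LinearMap.injective_codRestrict_iff ..).mpr hj, fun ⟨y, hy⟩ => ?_⟩⟩
  obtain ⟨f, hf⟩ := exists_comp_eq_of_ker_le j (J.liftQ (LinearMap.toSpanSingleton R E y)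
    (fun r hr => mem_annIn.mp hy r hr)) (by rw [LinearMap.ker_eq_bot.mpr hj]; exact bot_le)
  obtain ⟨s, hs⟩ := he.exists_eq_smul_on_annIn_pow f n
  have hfy : f (j 1) = y :=
    (LinearMap.congr_fun hf (J.mkQ 1)).trans (one_smul R y)
  refine ⟨s • 1, Subtype.ext ?_⟩
  rw [map_smul]
  exact (hs _ (annIn_antitone hJ (hj_mem 1))).symm.trans hfy

end IsMonolithGenerator

end Injective

section MulHom

variable {R : Type u} [CommRing R] (E : Type u) [AddCommGroup E] [Module R E] (I : Ideal R)

/-- The map `E → Hom_R(I, E)`, `y ↦ (x ↦ x • y)`, which identifies `I^∨` with `E / ann_E(I)` when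
`E` is injective. -/
def mulHom : E →ₗ[R] (I →ₗ[R] E) :=
  (LinearMap.lsmul R E ∘ₗ I.subtype).flip

theorem ker_mulHom : LinearMap.ker (mulHom E I) = annIn E I := by
  ext y
  simp [mulHom, LinearMap.ext_iff, mem_annIn]

theorem mulHom_surjective [Module.Injective R E] : Function.Surjective (mulHom E I) := fun f => by
  obtain ⟨g, rfl⟩ := exists_comp_eq_of_ker_le I.subtype f (by simp)
  exact ⟨g 1, LinearMap.ext fun x => by simp [mulHom, ← map_smul]⟩

end MulHom

section LinearMaps

variable {R : Type u} [CommRing R] {M N : Type u} [AddCommGroup M] [Module R M] [AddCommGroup N]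
  [Module R N]

theorem isArtinian_quotient_comap (f : M →ₗ[R] N) {L : Submodule R N}
    (h : IsArtinian R (N ⧸ L)) : IsArtinian R (M ⧸ L.comap f) :=
  isArtinian_of_injective ((L.comap f).mapQ L f le_rfl) <| LinearMap.ker_eq_bot.mp <| by
    rw [Submodule.ker_mapQ, ← LinearMap.le_ker_iff_map, Submodule.ker_mkQ]

theorem exists_fg_map_eq {f : M →ₗ[R] N} (hf : Function.Surjective f) {U : Submodule R N}
    (hU : U.FG) : ∃ V : Submodule R M, V.FG ∧ V.map f = U := by
  induction U, hU using Submodule.fg_induction with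
  | singleton y =>
    obtain ⟨x, rfl⟩ := hf y
    exact ⟨R ∙ x, Submodule.fg_span_singleton x, by rw [Submodule.map_span, Set.image_singleton]⟩
  | sup U U' _ _ hU hU' =>
    obtain ⟨V, hV, rfl⟩ := hU
    obtain ⟨V', hV', rfl⟩ := hU'
    exact ⟨V ⊔ V', hV.sup hV', Submodule.map_sup ..⟩

end LinearMaps

namespace ArtinianSelector

variable {R : Type u} [CommRing R] (α : ArtinianSelector R) {M N E : Type u} [AddCommGroup M]
  [Module R M] [AddCommGroup N] [Module R N] [AddCommGroup E] [Module R E]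

theorem le_cl (L : Submodule R M) (h : IsArtinian R (M ⧸ L)) : L ≤ α.cl L h :=
  (Submodule.ker_mkQ L).ge.trans (LinearMap.ker_le_comap _)

theorem cl_eq_comap_sel [IsArtinian R N] {f : M →ₗ[R] N} (hf : Function.Surjective f)
    {L : Submodule R M} (hL : LinearMap.ker f = L) (h : IsArtinian R (M ⧸ L)) :
    α.cl L h = (α.sel N).comap f := by
  subst hL
  let φ := f.quotKerEquivOfSurjective hf
  ext x
  rw [Submodule.mem_comap, ← α.map_equiv _ _ φ, Submodule.mem_map_equiv]
  exact iff_of_eq (congrArg (· ∈ α.sel _) (φ.symm_apply_apply (Submodule.mkQ _ x)).symm)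

theorem annihilator_cl_annIn_quotient {J : Ideal R} (I : Ideal R) (hJ : IsArtinian R (R ⧸ J)) :
    (α.cl (annIn (R ⧸ J) I) inferInstance).annihilator = α.colonClColon J I hJ := by
  have hker : LinearMap.ker ((annIn (R ⧸ J) I).mkQ ∘ₗ J.mkQ) = idealColon J I := by
    rw [LinearMap.ker_comp, Submodule.ker_mkQ, comap_mkQ_annIn]
  have hsurj : Function.Surjective ((annIn (R ⧸ J) I).mkQ ∘ₗ J.mkQ) :=
    (annIn (R ⧸ J) I).mkQ_surjective.comp J.mkQ_surjective
  rw [colonClColon, α.cl_eq_comap_sel hsurj hker, Submodule.comap_comp, idealColon_comap_mkQ]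
  rfl

theorem mem_smile_iff {h : IsArtinian R (M →ₗ[R] E)} {x : M} :
    x ∈ α.smile E M h ↔ ∀ f ∈ α.sel (M →ₗ[R] E), f x = 0 := by
  refine ⟨?_, fun hx => ⟨(α.sel (M →ₗ[R] E)).liftQ (LinearMap.applyₗ x) hx, rfl⟩⟩
  rintro ⟨g, hg⟩ f hf
  rw [← LinearMap.applyₗ_apply_apply, ← hg]
  exact (congrArg g ((Submodule.Quotient.mk_eq_zero _).mpr hf)).trans (map_zero g)

theorem smileIdeal_eq_annihilator_cl [IsLocalRing R] [Module.Injective R E] {e : E}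
    (he : IsMonolithGenerator R e) (I : Ideal R) (hI : IsArtinian R (I →ₗ[R] E))
    (h : IsArtinian R (E ⧸ annIn E I)) :
    α.smileIdeal E I hI = (α.cl (annIn E I) h).annihilator := by
  have hle : (α.cl (annIn E I) h).annihilator ≤ I :=
    (Submodule.annihilator_mono (α.le_cl _ h)).trans (he.annihilator_annIn I).le
  have hcl := α.cl_eq_comap_sel (mulHom_surjective E I) (ker_mulHom E I) h
  ext r
  refine ⟨?_, fun hr => ⟨⟨r, hle hr⟩, α.mem_smile_iff.mpr fun f hf => ?_, rfl⟩⟩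
  · rintro ⟨x, hx, rfl⟩
    exact Submodule.mem_annihilator.mpr fun y hy => α.mem_smile_iff.mp hx _ (hcl.le hy)
  · obtain ⟨y, rfl⟩ := mulHom_surjective E I f
    exact Submodule.mem_annihilator.mp hr y (hcl.ge hf)

end ArtinianSelector

namespace ArtinianPreradical

variable {R : Type u} [CommRing R] (α : ArtinianPreradical R) {M N : Type u} [AddCommGroup M]
  [Module R M] [AddCommGroup N] [Module R N]

theorem sel_le_comap_sel [IsArtinian R M] [IsArtinian R N] (f : M →ₗ[R] N) :
    α.sel M ≤ (α.sel N).comap f :=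
  Submodule.map_le_iff_le_comap.mp (α.functorial M N f)

theorem cl_le_comap_cl {L : Submodule R M} {P : Submodule R N} (hL : IsArtinian R (M ⧸ L))
    (hP : IsArtinian R (N ⧸ P)) {f : M →ₗ[R] N} (h : L ≤ P.comap f) :
    α.cl L hL ≤ (α.cl P hP).comap f :=
  Submodule.comap_mono (α.sel_le_comap_sel (L.mapQ P f h))

theorem annihilator_cl_annIn_le_of_injective [IsArtinian R M] [IsArtinian R N] {f : M →ₗ[R] N}
    (hf : Function.Injective f) (I : Ideal R) :
    (α.cl (annIn N I) inferInstance).annihilator ≤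
      (α.cl (annIn M I) inferInstance).annihilator := fun r hr =>
  Submodule.mem_annihilator.mpr fun x hx => hf <| by
    rw [map_smul, map_zero]
    exact Submodule.mem_annihilator.mp hr _ (α.cl_le_comap_cl _ _ (annIn_le_comap f I) hx)

theorem mem_finitistic_sel [IsArtinian R N] {x : N} :
    x ∈ α.finitistic.sel N ↔ ∃ U : Submodule R N, U.FG ∧ x ∈ (α.sel U).map U.subtype := by
  change x ∈ ⋃ (U : Submodule R N) (_ : U.FG), ((α.sel U).map U.subtype : Set N) ↔ _
  simp only [Set.mem_iUnion, exists_prop, SetLike.mem_coe]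

theorem finitistic_sel_le [IsArtinian R N] : α.finitistic.sel N ≤ α.sel N := fun _ hx => by
  obtain ⟨U, -, hx⟩ := α.mem_finitistic_sel.mp hx
  exact α.functorial U N U.subtype hx

theorem finitistic_sel_eq_sel [IsArtinian R N] [Module.Finite R N] :
    α.finitistic.sel N = α.sel N := by
  refine le_antisymm α.finitistic_sel_le fun x hx => α.mem_finitistic_sel.mpr
    ⟨⊤, Module.Finite.fg_top, ⟨x, trivial⟩, ?_, rfl⟩
  exact α.sel_le_comap_sel (Submodule.topEquiv (R := R) (M := N)).symm.toLinearMap hx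

theorem finitistic_cl_le (L : Submodule R M) (h : IsArtinian R (M ⧸ L)) :
    α.finitistic.cl L h ≤ α.cl L h :=
  Submodule.comap_mono α.finitistic_sel_le

theorem finitistic_cl_eq_cl [Module.Finite R M] (L : Submodule R M) (h : IsArtinian R (M ⧸ L)) :
    α.finitistic.cl L h = α.cl L h :=
  congrArg (Submodule.comap L.mkQ) α.finitistic_sel_eq_sel

theorem mem_finitistic_cl {L : Submodule R M} (h : IsArtinian R (M ⧸ L)) {x : M} :
    x ∈ α.finitistic.cl L h ↔ ∃ V : Submodule R M, V.FG ∧ x ∈ (α.cl (L.comap V.subtype)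
      (isArtinian_quotient_comap V.subtype h)).map V.subtype := by
  refine ⟨fun hx => ?_, ?_⟩
  · obtain ⟨U, hU, hxU⟩ := α.mem_finitistic_sel.mp hx
    obtain ⟨W, hW, rfl⟩ := exists_fg_map_eq L.mkQ_surjective hU
    let V := W ⊔ R ∙ x
    have hxV : x ∈ V := Submodule.mem_sup_right (Submodule.mem_span_singleton_self x)
    obtain ⟨y, hy, hyx⟩ := α.sel_le (Submodule.map_mono (le_sup_left : W ≤ V)) hxU
    refine ⟨V, hW.sup (Submodule.fg_span_singleton x), ⟨x, hxV⟩, ?_, rfl⟩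
    have hker : LinearMap.ker (L.mkQ.submoduleMap V) = L.comap V.subtype := by
      ext z
      simp [Subtype.ext_iff]
    rw [SetLike.mem_coe, α.cl_eq_comap_sel (L.mkQ.submoduleMap_surjective V) hker]
    have hy_eq : y = L.mkQ.submoduleMap V ⟨x, hxV⟩ := Subtype.ext hyx
    exact hy_eq.subst (motive := (· ∈ α.sel _)) hy
  · rintro ⟨V, hV, y, hy, rfl⟩
    have := Module.Finite.of_fg hV
    rw [SetLike.mem_coe, ← α.finitistic_cl_eq_cl] at hy
    exact α.finitistic.cl_le_comap_cl _ h le_rfl hy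

theorem annihilator_finitistic_cl_annIn_eq_iInf_fg [IsArtinian R M] (I : Ideal R) :
    (α.finitistic.cl (annIn M I) inferInstance).annihilator =
      ⨅ (V : Submodule R M) (_ : V.FG), (α.cl (annIn V I) inferInstance).annihilator := by
  ext r
  simp only [Submodule.mem_iInf, Submodule.mem_annihilator, mem_finitistic_cl,
    comap_annIn_of_injective (Submodule.injective_subtype _)]
  constructor
  · exact fun h V hV x hx => Subtype.ext (h x ⟨V, hV, x, hx, rfl⟩)
  · rintro h _ ⟨V, hV, x, hx, rfl⟩
    exact congrArg Subtype.val (h V hV x hx)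

end ArtinianPreradical

section CofinalWithPowers

variable {R : Type u} [CommRing R] [IsLocalRing R] {J : ℕ → Ideal R}

theorem CofinalWithPowers.isPowerTorsion_quotient (hJ : CofinalWithPowers J) (t : ℕ) :
    IsPowerTorsion (maximalIdeal R) (R ⧸ J t) :=
  (hJ.2 t).elim fun _ hn => isPowerTorsion_quotient_of_pow_le hn

theorem CofinalWithPowers.isFiniteLength_quotient [IsNoetherianRing R] (hJ : CofinalWithPowers J)
    (t : ℕ) : IsFiniteLength R (R ⧸ J t) :=
  isFiniteLength_iff_isNoetherian_isArtinian.mpr ⟨inferInstance, hJ.isArtinian_quotient t⟩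

end CofinalWithPowers

section InjectiveHull

variable {R : Type u} [CommRing R] [IsLocalRing R] {E : Type u} [AddCommGroup E] [Module R E]
  [Module.Injective R E] [IsArtinian R E] {e : E} (he : IsMonolithGenerator R e)
  (α : ArtinianPreradical R) (I : Ideal R)

namespace IsMonolithGenerator

include he

theorem annihilator_cl_annIn_le (M : Type u) [AddCommGroup M] [Module R M] [IsArtinian R M] :
    (α.cl (annIn E I) inferInstance).annihilator ≤
      (α.cl (annIn M I) inferInstance).annihilator :=
  he.annihilator_le_annihilator fun f => α.cl_le_comap_cl _ _ (annIn_le_comap f I)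

theorem annihilator_cl_annIn_eq_iInf :
    (α.cl (annIn E I) inferInstance).annihilator =
      ⨅ (M : Type u) (_ : AddCommGroup M) (_ : Module R M) (_ : IsArtinian R M),
        (α.cl (annIn M I) inferInstance).annihilator :=
  le_antisymm
    (le_iInf fun M => le_iInf fun _ => le_iInf₂ fun _ _ => he.annihilator_cl_annIn_le α I M)
    (iInf_le_of_le E <| iInf_le_of_le _ <| iInf₂_le _ ‹_›)

theorem annihilator_finitistic_cl_annIn_le_of_finite (M : Type u) [AddCommGroup M] [Module R M]
    [Module.Finite R M] [IsArtinian R M] :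
    (α.finitistic.cl (annIn E I) inferInstance).annihilator ≤
      (α.cl (annIn M I) inferInstance).annihilator := by
  rw [← α.finitistic_cl_eq_cl]
  exact he.annihilator_cl_annIn_le α.finitistic I M

theorem annihilator_finitistic_cl_annIn_eq_iInf_isFiniteLength [IsNoetherianRing R] :
    (α.finitistic.cl (annIn E I) inferInstance).annihilator =
      ⨅ (M : Type u) (_ : AddCommGroup M) (_ : Module R M) (hM : IsFiniteLength R M),
        (α.cl (annIn M I)
          (have := isArtinian_of_isFiniteLength hM; inferInstance)).annihilator := by
  refine le_antisymm (le_iInf fun M => le_iInf fun _ => le_iInf₂ fun _ hM => ?_) ?_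
  · obtain ⟨_, _⟩ := isFiniteLength_iff_isNoetherian_isArtinian.mp hM
    exact he.annihilator_finitistic_cl_annIn_le_of_finite α I M
  · rw [α.annihilator_finitistic_cl_annIn_eq_iInf_fg]
    refine le_iInf₂ fun V hV => ?_
    have := Module.Finite.of_fg hV
    exact iInf_le_of_le V <| iInf_le_of_le _ <| iInf₂_le _
      (isFiniteLength_iff_isNoetherian_isArtinian.mpr ⟨inferInstance, inferInstance⟩)

theorem annihilator_finitistic_cl_annIn_le_colonClColon {J : Ideal R}
    (hJ : IsArtinian R (R ⧸ J)) :
    (α.finitistic.cl (annIn E I) inferInstance).annihilator ≤ α.colonClColon J I hJ := by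
  rw [← α.annihilator_cl_annIn_quotient]
  exact he.annihilator_finitistic_cl_annIn_le_of_finite α I (R ⧸ J)

theorem annihilator_finitistic_cl_annIn_eq_iInf_colonClColon [IsNoetherianRing R]
    {J : ℕ → Ideal R} (hJ : CofinalWithPowers J)
    (hmono : ∀ t, ∃ x : R ⧸ J t, IsMonolithGenerator R x) :
    (α.finitistic.cl (annIn E I) inferInstance).annihilator =
      ⨅ t, α.colonClColon (J t) I (hJ.isArtinian_quotient t) := by
  refine le_antisymm
    (le_iInf fun t => he.annihilator_finitistic_cl_annIn_le_colonClColon α I _) ?_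
  rw [α.annihilator_finitistic_cl_annIn_eq_iInf_fg]
  refine le_iInf₂ fun V hV => ?_
  obtain ⟨n, hn⟩ := he.isPowerTorsion.exists_le_annIn_pow hV
  obtain ⟨t, ht⟩ := hJ.1 n
  obtain ⟨m, hm⟩ := hJ.2 t
  obtain ⟨x, hx⟩ := hmono t
  obtain ⟨φ⟩ := he.nonempty_quotient_equiv_annIn hm hx
  have hVJ : V ≤ annIn E (J t) := hn.trans (annIn_antitone ht)
  have hinj : Function.Injective (φ.symm.toLinearMap ∘ₗ Submodule.inclusion hVJ) :=
    φ.symm.injective.comp (Submodule.inclusion_injective hVJ)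
  have := hJ.isArtinian_quotient t
  refine iInf_le_of_le t ?_
  rw [← α.annihilator_cl_annIn_quotient]
  exact α.annihilator_cl_annIn_le_of_injective hinj I

end IsMonolithGenerator

end InjectiveHull

theorem mainTheorem5_general (R : Type u) [CommRing R] [IsLocalRing R] [IsNoetherianRing R]
    (E : Type u) [AddCommGroup E] [Module R E]
    (hE : IsInjectiveHull R (IsLocalRing.ResidueField R) E)
    (α : ArtinianPreradical R)
    (I : Ideal R) :
    ∃ (_ : IsArtinian R E) (hI : IsArtinian R (I →ₗ[R] E)),
      α.smileIdeal E I hI = (α.cl (annIn E I) inferInstance).annihilator ∧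
      α.smileIdeal E I hI =
        (⨅ (M : Type u) (_ : AddCommGroup M) (_ : Module R M) (_ : IsArtinian R M),
          (α.cl (annIn M I) inferInstance).annihilator) ∧
      α.smileIdeal E I hI ≤ α.finitistic.smileIdeal E I hI ∧
      α.finitistic.smileIdeal E I hI =
        (α.finitistic.cl (annIn E I) inferInstance).annihilator ∧
      α.finitistic.smileIdeal E I hI =
        (⨅ (M : Submodule R E) (_ : M.FG), (α.cl (annIn M I) inferInstance).annihilator) ∧
      α.finitistic.smileIdeal E I hI =
        (⨅ (M : Type u) (_ : AddCommGroup M) (_ : Module R M) (hM : IsFiniteLength R M),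
          (α.cl (annIn M I)
            (have := isArtinian_of_isFiniteLength hM; inferInstance)).annihilator) ∧
      α.finitistic.smileIdeal E I hI ≤
        (⨅ (J : Ideal R) (hJ : IsFiniteLength R (R ⧸ J)),
          (α.cl (annIn (R ⧸ J) I)
            (have := isArtinian_of_isFiniteLength hJ; inferInstance)).annihilator) ∧
      (⨅ (J : Ideal R) (hJ : IsFiniteLength R (R ⧸ J)),
          (α.cl (annIn (R ⧸ J) I)
            (have := isArtinian_of_isFiniteLength hJ; inferInstance)).annihilator) =
        (⨅ (J : Ideal R) (hJ : IsFiniteLength R (R ⧸ J)),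
          α.colonClColon J I (isArtinian_of_isFiniteLength hJ)) ∧
      (IsApproximatelyGorenstein R →
        α.finitistic.smileIdeal E I hI =
          (⨅ (J : Ideal R) (hJ : IsFiniteLength R (R ⧸ J)),
            α.colonClColon J I (isArtinian_of_isFiniteLength hJ))) ∧
      ∀ (J : ℕ → Ideal R), (∀ t, InfIrred (J t)) → ∀ hJ : CofinalWithPowers J,
        α.finitistic.smileIdeal E I hI =
          ⨅ t : ℕ, α.colonClColon (J t) I (hJ.isArtinian_quotient t) := by
  have : Module.Injective R E := hE.1
  have : IsSimpleModule R (ResidueField R) :=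
    isSimpleModule_iff_isCoatom.mpr (Ideal.isMaximal_def.mp (maximalIdeal.isMaximal R))
  obtain ⟨e, he⟩ := hE.exists_isMonolithGenerator
  have hA : IsArtinian R E := he.isArtinian
  have hI : IsArtinian R (I →ₗ[R] E) := isArtinian_of_surjective E _ (mulHom_surjective E I)
  refine ⟨hA, hI, ?_⟩
  rw [α.smileIdeal_eq_annihilator_cl he I hI inferInstance,
    α.finitistic.smileIdeal_eq_annihilator_cl he I hI inferInstance]
  have hle := le_iInf₂ fun (J : Ideal R) (hJ : IsFiniteLength R (R ⧸ J)) =>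
    he.annihilator_finitistic_cl_annIn_le_colonClColon α I (isArtinian_of_isFiniteLength hJ)
  have hcolon := iInf_congr fun J : Ideal R => iInf_congr fun hJ : IsFiniteLength R (R ⧸ J) =>
    α.annihilator_cl_annIn_quotient I (isArtinian_of_isFiniteLength hJ)
  refine ⟨rfl, he.annihilator_cl_annIn_eq_iInf α I,
    Submodule.annihilator_mono (α.finitistic_cl_le _ _), rfl,
    α.annihilator_finitistic_cl_annIn_eq_iInf_fg I,
    he.annihilator_finitistic_cl_annIn_eq_iInf_isFiniteLength α I, hle.trans_eq hcolon.symm,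
    hcolon, ?_, fun J hirr hJ => ?_⟩
  · rintro ⟨J, -, hJ, hsimple⟩
    refine hle.antisymm ?_
    rw [he.annihilator_finitistic_cl_annIn_eq_iInf_colonClColon α I hJ fun t =>
      (hJ.isPowerTorsion_quotient t).exists_isMonolithGenerator_of_isSimpleModule_annIn]
    exact le_iInf fun t => iInf₂_le (J t) (hJ.isFiniteLength_quotient t)
  · exact he.annihilator_finitistic_cl_annIn_eq_iInf_colonClColon α I hJ fun t =>
      (hJ.isPowerTorsion_quotient t).exists_isMonolithGenerator_of_infIrred_bot
        (infIrred_bot_quotient (hirr t))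

theorem mainTheorem5 (R : Type u) [CommRing R] [IsLocalRing R] [IsNoetherianRing R]
    [IsAdicComplete (IsLocalRing.maximalIdeal R) R]
    (E : Type u) [AddCommGroup E] [Module R E]
    (hE : IsInjectiveHull R (IsLocalRing.ResidueField R) E)
    (α : ArtinianPreradical R)
    (hcl : IsClosureOperation (fun _ _ _ L h => α.cl L h))
    (hclf : IsClosureOperation (fun _ _ _ L h => α.finitistic.cl L h))
    (I : Ideal R) :
    -- `E` and `Hom_R(I, E)` are Artinian, so that `α` is defined on them and on `E / ann_E(I)`
    ∃ (_ : IsArtinian R E) (hI : IsArtinian R (I →ₗ[R] E)),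
      α.smileIdeal E I hI = (α.cl (annIn E I) inferInstance).annihilator ∧
      α.smileIdeal E I hI =
        (⨅ (M : Type u) (_ : AddCommGroup M) (_ : Module R M) (_ : IsArtinian R M),
          (α.cl (annIn M I) inferInstance).annihilator) ∧
      α.smileIdeal E I hI ≤ α.finitistic.smileIdeal E I hI ∧
      α.finitistic.smileIdeal E I hI =
        (α.finitistic.cl (annIn E I) inferInstance).annihilator ∧
      α.finitistic.smileIdeal E I hI =
        (⨅ (M : Submodule R E) (_ : M.FG), (α.cl (annIn M I) inferInstance).annihilator) ∧
      α.finitistic.smileIdeal E I hI =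
        (⨅ (M : Type u) (_ : AddCommGroup M) (_ : Module R M) (hM : IsFiniteLength R M),
          (α.cl (annIn M I)
            (have := isArtinian_of_isFiniteLength hM; inferInstance)).annihilator) ∧
      α.finitistic.smileIdeal E I hI ≤
        (⨅ (J : Ideal R) (hJ : IsFiniteLength R (R ⧸ J)),
          (α.cl (annIn (R ⧸ J) I)
            (have := isArtinian_of_isFiniteLength hJ; inferInstance)).annihilator) ∧
      (⨅ (J : Ideal R) (hJ : IsFiniteLength R (R ⧸ J)),
          (α.cl (annIn (R ⧸ J) I)
            (have := isArtinian_of_isFiniteLength hJ; inferInstance)).annihilator) =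
        (⨅ (J : Ideal R) (hJ : IsFiniteLength R (R ⧸ J)),
          α.colonClColon J I (isArtinian_of_isFiniteLength hJ)) ∧
      (IsApproximatelyGorenstein R →
        α.finitistic.smileIdeal E I hI =
          (⨅ (J : Ideal R) (hJ : IsFiniteLength R (R ⧸ J)),
            α.colonClColon J I (isArtinian_of_isFiniteLength hJ)) ∧
        ∀ (J : ℕ → Ideal R), Antitone J → (∀ t, InfIrred (J t)) →
          ∀ hJ : CofinalWithPowers J,
            α.finitistic.smileIdeal E I hI =
              ⨅ t : ℕ, α.colonClColon (J t) I (hJ.isArtinian_quotient t)) := by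
  obtain ⟨hA, hI, h₁, h₂, h₃, h₄, h₅, h₆, h₇, h₈, hG, hirr⟩ := mainTheorem5_general R E hE α I
  exact ⟨hA, hI, h₁, h₂, h₃, h₄, h₅, h₆, h₇, h₈, fun h => ⟨hG h, fun J _ => hirr J⟩⟩
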